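/- For a finite group $G$ let $D(G)$ be the quantum double of the group algebra $\mathbb{C}G$: the complex algebra with linear basis $\{gh^* : g,h\in G\}$ and product determined by $h^*k=k\,(k^{-1}hk)^*$ and $g^*h^*=\delta(g,h)h^*$ (where $g=\sum_h gh^*$ and $h^*=eh^*$ are regarded as elements of $D(G)$), with universal $R$-matrix $R=\sum_{g\in G}g\otimes g^*$. For a $D(G)$-module $V$ denote by $R$ also the induced operator on $V\otimes V$, and put $\check R=PR$ with $P(x\otimes y)=y\otimes x$. For $n\ge 1$ let $D_n=\langle\sigma,\tau \mid \sigma^n=\tau^2=e,\ \tau\sigma=\sigma^{n-1}\tau\rangle$ be the dihedral group of order $2n$. For $a,b\in\{0,1\}$ put $$\check R_{a,b}=(-1)^b \begin{bmatrix} 1 & 0 & 0 & 0 & 0 & 0 & 0 & 0 & 0 \\ 0 & 0 & 0 & 0 & 0 & 1 & 0 & 0 & 0 \\ 0 & 0 & 0 & 0 & 0 & 0 & 0 & (-1)^a & 0 \\ 0 & 0 & (-1)^a & 0 & 0 & 0 & 0 & 0 & 0 \\ 0 & 0 & 0 & 0 & 1 & 0 & 0 & 0 & 0 \\ 0 & 0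 & 0 & 0 & 0 & 0 & (-1)^a & 0 & 0 \\ 0 & (-1)^a & 0 & 0 & 0 & 0 & 0 & 0 & 0 \\ 0 & 0 & 0 & 1 & 0 & 0 & 0 & 0 & 0 \\ 0 & 0 & 0 & 0 & 0 & 0 & 0 & 0 & 1 \end{bmatrix}.$$ 1. $D(D_n)$ has an irreducible three-dimensional representation if and only if $n=3$ or $n=6$. 2. For every irreducible three-dimensional representation $V$ of $D(D_n)$, the operator $R$ satisfies the constant Yang--Baxter equation $R_{12}R_{13}R_{23}=R_{23}R_{13}R_{12}$ and $\check R$ satisfies $\check R_{12}\check R_{23}\check R_{12}=\check R_{23}\check R_{12}\check R_{23}$. Moreover there are $a,b\in\{0,1\}$ and a basis $e_1,e_2,e_3$ of $V$, in which every $g\in D_n$ acts by a unitary matrix and every $h^*$ by a Hermitian matrix, such that the matrix of $\check R$ in the basis $e_1\otimes e_1,\,e_2\otimes e_1,\,e_3\otimes e_1,\,e_1\otimes e_2,\dots,e_3\otimes e_3$ of $V\otimes V$ is $\check R_{a,b}$. Here $a=0$ if $n=3$, and $(-1)^a$ is the scalar by which $\sigma^3$ acts if $n=6$. 3. For fixed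 $b$ the two matrices $\check R_{0,b}$ and $\check R_{1,b}$ are unitarily equivalent: there is a unitary $3\times3$ matrix $U$ with $(U\otimes U)\check R_{0,b}(U\otimes U)^{*}=\check R_{1,b}$. 4. Up to an overall sign all these solutions are unitarily equivalent: if $V$ and $W$ are irreducible three-dimensional representations of $D(D_n)$ and $D(D_m)$ on inner product spaces, unitary in the sense that group elements act by unitary operators and the $h^*$ by self-adjoint operators, then there are a unitary isomorphism $U:V\to W$ and a sign $\varepsilon\in\{1,-1\}$ with $(U\otimes U)\,\check R_V=\varepsilon\,\check R_W\,(U\otimes U)$. -/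

import Mathlib

open scoped TensorProduct Kronecker

universe u v

/-- The quantum double `D(G)` of the group algebra of a finite group `G` over `ℂ`, with linear basis
the products `g h*` (`g, h ∈ G`). The value `a g h` is the coefficient of `g h*` in `a`. -/
def QuantumDouble (G : Type*) : Type _ := G → G → ℂ

namespace QuantumDouble

noncomputable section

instance (G : Type*) : AddCommGroup (QuantumDouble G) := inferInstanceAs (AddCommGroup (G → G → ℂ))

instance (G : Type*) : Module ℂ (QuantumDouble G) := inferInstanceAs (Module ℂ (G → G → ℂ))

section Algebra

variable {G : Type*} [Group G] [Fintype G] [DecidableEq G]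

/-- The bilinear product determined by `h* k = k (k⁻¹ h k)*` and `h* y* = δ(h, y) y*`, that is, by
`(g h*) (k y*) = δ(k⁻¹ h k, y) (g k) y*`. So the coefficient of `x y*` in `a b` is the sum, over all
factorisations `x = g k`, of the coefficient of `g (k y k⁻¹)*` in `a` times that of `k y*` in `b`. -/
instance : Mul (QuantumDouble G) :=
  ⟨fun a b x y => ∑ k : G, a (x * k⁻¹) (k * y * k⁻¹) * b k y⟩

/-- The unit is `∑ h, e h*`. -/
instance : One (QuantumDouble G) := ⟨fun x _ => if x = 1 then 1 else 0⟩

set_option linter.unusedSectionVars false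

theorem add_apply (a b : QuantumDouble G) (x y : G) : (a + b) x y = a x y + b x y := rfl

theorem smul_apply (c : ℂ) (a : QuantumDouble G) (x y : G) : (c • a) x y = c * a x y := rfl

theorem mul_apply (a b : QuantumDouble G) (x y : G) :
    (a * b) x y = ∑ k : G, a (x * k⁻¹) (k * y * k⁻¹) * b k y := rfl

theorem one_apply (x y : G) : (1 : QuantumDouble G) x y = if x = 1 then 1 else 0 := rfl

instance : Ring (QuantumDouble G) :=
  { (inferInstance : AddCommGroup (QuantumDouble G)) with
    mul := (· * ·)
    one := 1
    left_distrib := fun a b c => by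
      funext x y
      simp only [mul_apply, add_apply, mul_add, Finset.sum_add_distrib]
    right_distrib := fun a b c => by
      funext x y
      simp only [mul_apply, add_apply, add_mul, Finset.sum_add_distrib]
    zero_mul := fun a => by
      funext x y
      exact Finset.sum_eq_zero fun k _ => zero_mul _
    mul_zero := fun a => by
      funext x y
      exact Finset.sum_eq_zero fun k _ => mul_zero _
    one_mul := fun a => by
      funext x y
      rw [mul_apply, Finset.sum_eq_single x]
      · simp [one_apply]
      · intro k _ hk
        have : x * k⁻¹ ≠ 1 := fun h => hk (mul_inv_eq_one.mp h).symm
        simp [one_apply, this]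
      · simp
    mul_one := fun a => by
      funext x y
      rw [mul_apply, Finset.sum_eq_single 1]
      · simp [one_apply]
      · intro k _ hk
        simp [one_apply, hk]
      · simp
    mul_assoc := fun a b c => by
      funext x y
      simp only [mul_apply, Finset.sum_mul, Finset.mul_sum]
      conv_rhs => rw [Finset.sum_comm]
      refine Finset.sum_congr rfl fun k _ => ?_
      refine Fintype.sum_equiv (Equiv.mulRight k) _ _ fun m => ?_
      simp [mul_assoc] }

instance : Algebra ℂ (QuantumDouble G) :=
  Algebra.ofModule
    (fun c a b => by
      funext x y
      simp only [mul_apply, smul_apply, Finset.mul_sum, mul_assoc])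
    (fun c a b => by
      funext x y
      simp only [mul_apply, smul_apply, Finset.mul_sum, mul_left_comm])

/-- The basis element `g h*`. -/
def basisElem (g h : G) : QuantumDouble G := fun x y => if x = g ∧ y = h then 1 else 0

/-- The element `g* = e g*` of `D(G)`. -/
def dual (g : G) : QuantumDouble G := basisElem 1 g

/-- The element `g = g ε` of `D(G)`, where `ε = ∑ h, h*`. -/
def ofGroup (g : G) : QuantumDouble G := ∑ h : G, basisElem g h

end Algebra

section RMatrix

variable (G : Type*) [Group G] [Fintype G] [DecidableEq G]

/-- The universal `R`-matrix `∑ g, g ⊗ g*` of `D(G)`. -/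
def universalR : QuantumDouble G ⊗[ℂ] QuantumDouble G := ∑ g : G, ofGroup g ⊗ₜ[ℂ] dual g

variable (V : Type*) [AddCommGroup V] [Module ℂ V] [Module (QuantumDouble G) V]
  [IsScalarTower ℂ (QuantumDouble G) V]

/-- The representation of `D(G)` on a module `V`. -/
def rep : QuantumDouble G →ₐ[ℂ] Module.End ℂ V := Algebra.lsmul (A := QuantumDouble G) ℂ ℂ V

/-- The representative on `V ⊗ V` of the universal `R`-matrix. -/
def R : Module.End ℂ (V ⊗[ℂ] V) :=
  (Module.endTensorEndAlgHom (R := ℂ) (S := ℂ) (A := ℂ) (M := V) (N := V))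
    (Algebra.TensorProduct.map (rep G V) (rep G V) (universalR G))

/-- `Ř = P R`, with `P (x ⊗ y) = y ⊗ x`. -/
def Rcheck : Module.End ℂ (V ⊗[ℂ] V) := (TensorProduct.comm ℂ V V).toLinearMap ∘ₗ R G V

end RMatrix

/-- The action of `D(G)` on a complex inner product space is unitary: every `g` acts by an isometry
and every `h*` by a self-adjoint operator. -/
structure IsUnitaryAction (G : Type*) [Group G] [Fintype G] [DecidableEq G] (V : Type*)
    [NormedAddCommGroup V] [InnerProductSpace ℂ V] [Module (QuantumDouble G) V] : Prop where
  inner_ofGroup : ∀ (g : G) (x y : V),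
    inner ℂ ((ofGroup g : QuantumDouble G) • x) ((ofGroup g : QuantumDouble G) • y) = inner ℂ x y
  inner_dual : ∀ (h : G) (x y : V),
    inner ℂ ((dual h : QuantumDouble G) • x) y = inner ℂ x ((dual h : QuantumDouble G) • y)

end

end QuantumDouble

namespace YangBaxter

noncomputable section

variable {V : Type*} [AddCommGroup V] [Module ℂ V]

/-- `T` acting on the first and second factors of `V ⊗ V ⊗ V`. -/
def leg12 (T : Module.End ℂ (V ⊗[ℂ] V)) : Module.End ℂ (V ⊗[ℂ] (V ⊗[ℂ] V)) :=
  (TensorProduct.assoc ℂ V V V).toLinearMap ∘ₗ T.rTensor V ∘ₗ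
    (TensorProduct.assoc ℂ V V V).symm.toLinearMap

/-- `T` acting on the second and third factors. -/
def leg23 (T : Module.End ℂ (V ⊗[ℂ] V)) : Module.End ℂ (V ⊗[ℂ] (V ⊗[ℂ] V)) :=
  T.lTensor V

/-- `T` acting on the first and third factors. -/
def leg13 (T : Module.End ℂ (V ⊗[ℂ] V)) : Module.End ℂ (V ⊗[ℂ] (V ⊗[ℂ] V)) :=
  leg23 (TensorProduct.comm ℂ V V).toLinearMap ∘ₗ leg12 T ∘ₗ
    leg23 (TensorProduct.comm ℂ V V).toLinearMap

/-- The constant Yang–Baxter equation `T₁₂ T₁₃ T₂₃ = T₂₃ T₁₃ T₁₂`. -/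
def IsConstantSolution (T : Module.End ℂ (V ⊗[ℂ] V)) : Prop :=
  leg12 T ∘ₗ leg13 T ∘ₗ leg23 T = leg23 T ∘ₗ leg13 T ∘ₗ leg12 T

/-- The constant braiding Yang–Baxter equation `T₁₂ T₂₃ T₁₂ = T₂₃ T₁₂ T₂₃`. -/
def IsBraidSolution (T : Module.End ℂ (V ⊗[ℂ] V)) : Prop :=
  leg12 T ∘ₗ leg23 T ∘ₗ leg12 T = leg23 T ∘ₗ leg12 T ∘ₗ leg23 T

end

end YangBaxter

namespace ThreeDim

noncomputable section

/-- The ordering `(1,1), (2,1), (3,1), (1,2), (2,2), …, (3,3)` of pairs of indices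
(the first index varies fastest). -/
def pairOrder : Fin 3 × Fin 3 ≃ Fin 9 := (Equiv.prodComm (Fin 3) (Fin 3)).trans finProdFinEquiv

/-- The basis `e₁⊗e₁, e₂⊗e₁, e₃⊗e₁, e₁⊗e₂, …, e₃⊗e₃` of `V ⊗ V`. -/
def tensorBasis {V : Type*} [AddCommGroup V] [Module ℂ V] (e : Module.Basis (Fin 3) ℂ V) :
    Module.Basis (Fin 9) ℂ (V ⊗[ℂ] V) :=
  (e.tensorProduct e).reindex pairOrder

/-- The matrix of `U ⊗ U` in the ordering `pairOrder`. -/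
def tensorSquare (U : Matrix (Fin 3) (Fin 3) ℂ) : Matrix (Fin 9) (Fin 9) ℂ :=
  Matrix.reindex pairOrder pairOrder (U ⊗ₖ U)

/-- The displayed matrix, with parameters `a` and `b` (only their parities matter). -/
def RcheckMatrix (a b : ℕ) : Matrix (Fin 9) (Fin 9) ℂ :=
  (-1 : ℂ) ^ b •
  !![1, 0, 0, 0, 0, 0, 0, 0, 0;
     0, 0, 0, 0, 0, 1, 0, 0, 0;
     0, 0, 0, 0, 0, 0, 0, (-1) ^ a, 0;
     0, 0, (-1) ^ a, 0, 0, 0, 0, 0, 0;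
     0, 0, 0, 0, 1, 0, 0, 0, 0;
     0, 0, 0, 0, 0, 0, (-1) ^ a, 0, 0;
     0, (-1) ^ a, 0, 0, 0, 0, 0, 0, 0;
     0, 0, 0, 1, 0, 0, 0, 0, 0;
     0, 0, 0, 0, 0, 0, 0, 0, 1]

end

end ThreeDim

/-! A `D(G)`-module is a `G`-graded space (the `h*` are the projections onto the degrees) with an
action of `G` in which `g` takes degree `h` to degree `g h g⁻¹`. The Yang–Baxter equations follow
from this for every finite `G` and every module.

For a dihedral group, let a simple module contain a nonzero homogeneous vector. If its degree is a
rotation, an eigenvector of `r 1` of that degree and its image under `sr 0` span the module, so the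
dimension is at most two (`finrank_le_two_of_rotation_degree`). If its degree is a reflection `sr
i`, let `m` be the additive order of `2` in `ℤ/n`. A joint eigenvector of the commuting involutions
`sr i` and `r m` has translates under the first `m` rotations with distinct degrees, and these form
a basis (`exists_basis_of_reflection_degree`). So dimension three means `m = 3`, that is `n = 3` or
`n = 6`; conversely, functions on the class of a reflection give such a module.

In the resulting basis `Ř` sends `e j ⊗ e k` to a signed `e k ⊗ e (2 * k - j)`, indices modulo 3:
the braiding of the dihedral quandle. The signs are `lam` and a coboundary built from `(1, nu, 1)`,
which rescaling the basis removes (`IsAdapted.Rcheck_tmul_smul`). Only the overall sign `lam`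
survives. In a unitary representation the rescaled basis can be made orthonormal, so matching two
such bases gives the unitary equivalence. -/

set_option linter.unusedSectionVars false

namespace QuantumDouble

/-! ### Relations between the generators of `D(G)`. -/

section Relations

variable {G : Type*} [Group G] [Fintype G] [DecidableEq G]

theorem ofGroup_apply (g x y : G) : (ofGroup g : QuantumDouble G) x y = if x = g then 1 else 0 := by
  have : (ofGroup g : QuantumDouble G) x y = ∑ h : G, basisElem g h x y := by
    unfold ofGroup
    exact (congrFun (Finset.sum_apply x Finset.univ fun h => (basisElem g h : G → G → ℂ)) y).trans
      (Finset.sum_apply y Finset.univ fun h => (basisElem g h : G → G → ℂ) x)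
  rw [this]
  by_cases hx : x = g <;> simp [basisElem, hx]

theorem dual_apply (h x y : G) :
    (dual h : QuantumDouble G) x y = if x = 1 ∧ y = h then 1 else 0 := rfl

theorem ofGroup_one : (ofGroup 1 : QuantumDouble G) = 1 := by
  funext x y
  rw [ofGroup_apply, one_apply]

theorem ofGroup_mul (g k : G) :
    (ofGroup (g * k) : QuantumDouble G) = ofGroup g * ofGroup k := by
  funext x y
  simp only [mul_apply, ofGroup_apply, mul_ite, mul_one, mul_zero, Finset.sum_ite_eq',
    Finset.mem_univ, if_true, mul_inv_eq_iff_eq_mul]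

theorem zero_apply (x y : G) : (0 : QuantumDouble G) x y = 0 := rfl

theorem dual_mul_dual (h k : G) :
    (dual h * dual k : QuantumDouble G) = if h = k then dual k else 0 := by
  funext x y
  rw [mul_apply, Finset.sum_eq_single 1]
  · by_cases hk : h = k
    · subst hk
      simp only [dual_apply, if_true]
      by_cases hx : x = 1 <;> by_cases hy : y = h <;> simp [hx, hy]
    · simp only [dual_apply, if_neg hk]
      by_cases hy : y = k
      · subst hy
        simp [Ne.symm hk, zero_apply]
      · simp [hy, zero_apply]
  · intro z _ hz
    simp [dual_apply, hz]
  · simp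

theorem dual_mul_ofGroup (h k : G) :
    (dual h * ofGroup k : QuantumDouble G) = ofGroup k * dual (k⁻¹ * h * k) := by
  funext x y
  rw [mul_apply, mul_apply, Finset.sum_eq_single k, Finset.sum_eq_single 1]
  · simp only [dual_apply, ofGroup_apply]
    have : k * y * k⁻¹ = h ↔ y = k⁻¹ * h * k := by
      constructor <;> rintro rfl <;> group
    by_cases hx : x = k
    · simp [hx, this]
    · have : x * k⁻¹ ≠ 1 := fun e => hx (mul_inv_eq_one.mp e)
      simp [hx, this]
  · intro z _ hz
    simp [dual_apply, hz]
  · simp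
  · intro z _ hz
    simp [ofGroup_apply, hz]
  · simp

theorem ofGroup_mul_dual (g h : G) :
    (ofGroup g * dual h : QuantumDouble G) = basisElem g h := by
  funext x y
  rw [mul_apply, Finset.sum_eq_single 1]
  · by_cases hx : x = g <;> by_cases hy : y = h <;> simp [ofGroup_apply, dual_apply, basisElem, hx, hy]
  · intro z _ hz
    simp [dual_apply, hz]
  · simp

theorem sum_apply {ι : Type*} (s : Finset ι) (f : ι → QuantumDouble G) (x y : G) :
    (∑ i ∈ s, f i) x y = ∑ i ∈ s, f i x y :=
  (congrFun (Finset.sum_apply x s fun i => (f i : G → G → ℂ)) y).trans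
    (Finset.sum_apply y s fun i => (f i : G → G → ℂ) x)

theorem sum_dual : ∑ h : G, (dual h : QuantumDouble G) = 1 := by
  rw [← ofGroup_one]
  rfl

/-- This reduces stability under `D(G)` to stability under the group elements and the degree
projections separately. -/
theorem eq_sum_smul (a : QuantumDouble G) :
    a = ∑ g : G, ∑ h : G, a g h • (ofGroup g * dual h) := by
  funext x y
  simp only [sum_apply, smul_apply, ofGroup_mul_dual, basisElem, ite_and]
  simp

end Relations

/-! ### Modules as graded spaces with a compatible group action. -/

section Modules

variable {G : Type*} [Group G] [Fintype G] [DecidableEq G]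
  {V : Type*} [AddCommGroup V] [Module ℂ V] [Module (QuantumDouble G) V]

theorem ofGroup_smul_smul (g k : G) (x : V) :
    (ofGroup g : QuantumDouble G) • (ofGroup k : QuantumDouble G) • x =
      (ofGroup (g * k) : QuantumDouble G) • x := by
  rw [ofGroup_mul, mul_smul]

theorem ofGroup_one_smul (x : V) : (ofGroup 1 : QuantumDouble G) • x = x := by
  rw [ofGroup_one, one_smul]

theorem dual_smul_dual_smul (h k : G) (x : V) :
    (dual h : QuantumDouble G) • (dual k : QuantumDouble G) • x =
      if h = k then (dual k : QuantumDouble G) • x else 0 := by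
  rw [← mul_smul, dual_mul_dual]
  split_ifs <;> simp

theorem dual_smul_ofGroup_smul (h k : G) (x : V) :
    (dual h : QuantumDouble G) • (ofGroup k : QuantumDouble G) • x =
      (ofGroup k : QuantumDouble G) • (dual (k⁻¹ * h * k) : QuantumDouble G) • x := by
  rw [← mul_smul, dual_mul_ofGroup, mul_smul]

/-- A vector of degree `h` is moved by `g` to degree `g h g⁻¹`. -/
theorem dual_smul_ofGroup_smul_of_degree {h : G} {x : V}
    (hx : ∀ k : G, (dual k : QuantumDouble G) • x = if k = h then x else 0) (g k : G) :
    (dual k : QuantumDouble G) • (ofGroup g : QuantumDouble G) • x =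
      if k = g * h * g⁻¹ then (ofGroup g : QuantumDouble G) • x else 0 := by
  rw [dual_smul_ofGroup_smul, hx]
  have : g⁻¹ * k * g = h ↔ k = g * h * g⁻¹ := by
    constructor <;> rintro rfl <;> group
  simp only [this]
  split_ifs <;> simp

variable [IsScalarTower ℂ (QuantumDouble G) V]

/-- The `h*` are orthogonal idempotents, so a vector fixed by one of them is killed by all the
others; it is homogeneous of degree `h`. -/
theorem dual_smul_of_fixed {h : G} {x : V} (hx : (dual h : QuantumDouble G) • x = x) (k : G) :
    (dual k : QuantumDouble G) • x = if k = h then x else 0 := by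
  conv_lhs => rw [← hx]
  rw [dual_smul_dual_smul, hx]

/-- The projections `h*` sum to `1`, so a nonzero vector has a nonzero homogeneous component. -/
theorem exists_dual_smul_eq_self [Nontrivial V] :
    ∃ (h : G) (x : V), x ≠ 0 ∧ (dual h : QuantumDouble G) • x = x := by
  obtain ⟨y, hy⟩ := exists_ne (0 : V)
  by_contra! H
  apply hy
  rw [← one_smul (QuantumDouble G) y, ← sum_dual, Finset.sum_smul]
  refine Finset.sum_eq_zero fun h _ => ?_
  by_contra hne
  exact H h _ hne (by rw [dual_smul_dual_smul, if_pos rfl])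

/-- A subspace of a simple module stable under all `g` and all `h*` is trivial. -/
theorem eq_top_of_stable [IsSimpleModule (QuantumDouble G) V] (S : Submodule ℂ V)
    (hg : ∀ (g : G), ∀ x ∈ S, (ofGroup g : QuantumDouble G) • x ∈ S)
    (hd : ∀ (h : G), ∀ x ∈ S, (dual h : QuantumDouble G) • x ∈ S)
    {x : V} (hx : x ∈ S) (hx0 : x ≠ 0) : S = ⊤ := by
  let T : Submodule (QuantumDouble G) V :=
    { S with
      smul_mem' := fun a y hy => by
        rw [eq_sum_smul a, Finset.sum_smul]
        refine S.sum_mem fun g _ => ?_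
        rw [Finset.sum_smul]
        refine S.sum_mem fun h _ => ?_
        rw [smul_assoc, mul_smul]
        exact S.smul_mem _ (hg _ _ (hd _ _ hy)) }
  have hT : T = ⊤ := (eq_bot_or_eq_top T).resolve_left fun h => hx0 (by
    have : x ∈ T := hx
    rwa [h, Submodule.mem_bot] at this)
  rw [Submodule.eq_top_iff']
  intro y
  have : y ∈ T := hT ▸ Submodule.mem_top
  exact this

variable (G) in
theorem R_tmul (x y : V) :
    R G V (x ⊗ₜ y) =
      ∑ g : G, ((ofGroup g : QuantumDouble G) • x) ⊗ₜ[ℂ] ((dual g : QuantumDouble G) • y) := by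
  simp only [R, universalR, map_sum, LinearMap.sum_apply]
  rfl

variable (G) in
theorem Rcheck_tmul (x y : V) :
    Rcheck G V (x ⊗ₜ y) =
      ∑ g : G, ((dual g : QuantumDouble G) • y) ⊗ₜ[ℂ] ((ofGroup g : QuantumDouble G) • x) := by
  simp [Rcheck, R_tmul]

/-- Only the term of `R` at the degree of `y` survives, which makes `Ř` computable in a homogeneous
basis. -/
theorem Rcheck_tmul_of_degree {h : G} {y : V}
    (hy : ∀ k : G, (dual k : QuantumDouble G) • y = if k = h then y else 0) (x : V) :
    Rcheck G V (x ⊗ₜ y) = y ⊗ₜ[ℂ] ((ofGroup h : QuantumDouble G) • x) := by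
  rw [Rcheck_tmul, Finset.sum_eq_single h]
  · rw [hy, if_pos rfl]
  · intro k _ hk
    rw [hy, if_neg hk, TensorProduct.zero_tmul]
  · simp

end Modules

/-! ### The Yang–Baxter equations for an arbitrary finite group. -/

section YangBaxterEquation

open YangBaxter

variable (G : Type*) [Group G] [Fintype G] [DecidableEq G]
  (V : Type*) [AddCommGroup V] [Module ℂ V] [Module (QuantumDouble G) V]
  [IsScalarTower ℂ (QuantumDouble G) V]

variable {V} in
theorem _root_.YangBaxter.leg12_tmul (T : Module.End ℂ (V ⊗[ℂ] V)) (x y z : V) :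
    leg12 T (x ⊗ₜ (y ⊗ₜ z)) = TensorProduct.assoc ℂ V V V (T (x ⊗ₜ y) ⊗ₜ z) := rfl

variable {V} in
theorem _root_.YangBaxter.leg23_tmul (T : Module.End ℂ (V ⊗[ℂ] V)) (x y z : V) :
    leg23 T (x ⊗ₜ (y ⊗ₜ z)) = x ⊗ₜ T (y ⊗ₜ z) := rfl

variable {V} in
theorem leg12_R_tmul (x y z : V) : leg12 (R G V) (x ⊗ₜ (y ⊗ₜ z)) =
    ∑ g : G, ((ofGroup g : QuantumDouble G) • x) ⊗ₜ[ℂ]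
      (((dual g : QuantumDouble G) • y) ⊗ₜ[ℂ] z) := by
  simp [leg12_tmul, R_tmul, TensorProduct.sum_tmul]

variable {V} in
theorem leg23_R_tmul (x y z : V) : leg23 (R G V) (x ⊗ₜ (y ⊗ₜ z)) =
    ∑ g : G, x ⊗ₜ[ℂ] (((ofGroup g : QuantumDouble G) • y) ⊗ₜ[ℂ]
      ((dual g : QuantumDouble G) • z)) := by
  simp [leg23_tmul, R_tmul, TensorProduct.tmul_sum]

variable {V} in
theorem leg13_R_tmul (x y z : V) : leg13 (R G V) (x ⊗ₜ (y ⊗ₜ z)) =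
    ∑ g : G, ((ofGroup g : QuantumDouble G) • x) ⊗ₜ[ℂ] (y ⊗ₜ[ℂ]
      ((dual g : QuantumDouble G) • z)) := by
  simp only [leg13, LinearMap.comp_apply, leg23_tmul, LinearEquiv.coe_coe, TensorProduct.comm_tmul,
    leg12_R_tmul, map_sum]

variable {V} in
theorem leg12_Rcheck_tmul (x y z : V) : leg12 (Rcheck G V) (x ⊗ₜ (y ⊗ₜ z)) =
    ∑ g : G, ((dual g : QuantumDouble G) • y) ⊗ₜ[ℂ]
      (((ofGroup g : QuantumDouble G) • x) ⊗ₜ[ℂ] z) := by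
  simp [leg12_tmul, Rcheck_tmul, TensorProduct.sum_tmul]

variable {V} in
theorem leg23_Rcheck_tmul (x y z : V) : leg23 (Rcheck G V) (x ⊗ₜ (y ⊗ₜ z)) =
    ∑ g : G, x ⊗ₜ[ℂ] (((dual g : QuantumDouble G) • z) ⊗ₜ[ℂ]
      ((ofGroup g : QuantumDouble G) • y)) := by
  simp [leg23_tmul, Rcheck_tmul, TensorProduct.tmul_sum]

variable {G} in
/-- Reindexing by conjugation moves `g` past the dual elements. -/
theorem sum_dual_smul_ofGroup_smul {M : Type*} [AddCommMonoid M] (f : V → V → M) (g : G)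
    (x y : V) :
    ∑ k : G, f ((ofGroup k : QuantumDouble G) • (ofGroup g : QuantumDouble G) • x)
        ((dual k : QuantumDouble G) • (ofGroup g : QuantumDouble G) • y) =
      ∑ k : G, f ((ofGroup g : QuantumDouble G) • (ofGroup k : QuantumDouble G) • x)
        ((ofGroup g : QuantumDouble G) • (dual k : QuantumDouble G) • y) := by
  refine (Fintype.sum_equiv (MulAut.conj g).toEquiv _ _ fun k => ?_).symm
  rw [dual_smul_ofGroup_smul, ofGroup_smul_smul, ofGroup_smul_smul]
  simp [mul_assoc]

/-- On each side two projections hit the third factor, and their orthogonality removes one of the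
three sums. The remaining double sums agree after conjugating one summation index by the other. -/
theorem isConstantSolution_R : IsConstantSolution (R G V) := by
  refine TensorProduct.ext_threefold' fun x y z => ?_
  simp only [LinearMap.comp_apply, leg12_R_tmul, leg23_R_tmul, leg13_R_tmul, map_sum,
    dual_smul_dual_smul, TensorProduct.tmul_ite,
    Finset.sum_ite_eq', Finset.mem_univ, if_true]
  conv_rhs => rw [Finset.sum_comm]
  exact Finset.sum_congr rfl fun g _ => sum_dual_smul_ofGroup_smul V
    (fun x' y' => x' ⊗ₜ[ℂ] (y' ⊗ₜ[ℂ] ((dual g : QuantumDouble G) • z))) g x y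

theorem isBraidSolution_Rcheck : IsBraidSolution (Rcheck G V) := by
  refine TensorProduct.ext_threefold' fun x y z => ?_
  simp only [LinearMap.comp_apply, leg12_Rcheck_tmul, leg23_Rcheck_tmul, map_sum,
    dual_smul_dual_smul, TensorProduct.ite_tmul,
    Finset.sum_ite_eq', Finset.mem_univ, if_true]
  conv_lhs => rw [Finset.sum_comm]
  exact Finset.sum_congr rfl fun g _ => (sum_dual_smul_ofGroup_smul V
    (fun x' y' => ((dual g : QuantumDouble G) • z) ⊗ₜ[ℂ] (y' ⊗ₜ[ℂ] x')) g x y).symm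

end YangBaxterEquation

end QuantumDouble

/-! ### Existence: functions on a conjugacy class. -/

namespace QuantumDouble

section Permutation

variable {G : Type*} [Group G] [Fintype G] [DecidableEq G] {X : Type*} [MulAction G X]
  (d : X → G)

/-- The operator by which `a ∈ D(G)` acts on functions on a `G`-set `X` over `G`
(a crossed `G`-set). -/
def permEnd (a : QuantumDouble G) : Module.End ℂ (X → ℂ) where
  toFun f x := ∑ g : G, a g (d (g⁻¹ • x)) * f (g⁻¹ • x)
  map_add' f f' := by
    funext x
    simp [mul_add, Finset.sum_add_distrib]
  map_smul' c f := by
    funext x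
    simp [Finset.mul_sum, mul_left_comm]

theorem permEnd_apply (a : QuantumDouble G) (f : X → ℂ) (x : X) :
    permEnd d a f x = ∑ g : G, a g (d (g⁻¹ • x)) * f (g⁻¹ • x) := rfl

/-- Moving a point by `k` conjugates its degree by `k`, which is exactly the twist in the product of
`D(G)`. -/
theorem permEnd_mul (hd : ∀ (g : G) (x : X), d (g • x) = g * d x * g⁻¹)
    (a b : QuantumDouble G) : permEnd d (a * b) = permEnd d a * permEnd d b := by
  refine LinearMap.ext fun f => funext fun x => ?_
  simp only [Module.End.mul_apply, permEnd_apply, mul_apply, Finset.sum_mul, Finset.mul_sum]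
  rw [Finset.sum_comm]
  conv_rhs => rw [Finset.sum_comm]
  refine Finset.sum_congr rfl fun k _ => ?_
  refine Fintype.sum_equiv (Equiv.mulRight k⁻¹) _ _ fun g => ?_
  simp [hd, mul_smul, mul_assoc]

/-- The representation of `D(G)` on functions on a crossed `G`-set. -/
def permRep (hd : ∀ (g : G) (x : X), d (g • x) = g * d x * g⁻¹) :
    QuantumDouble G →ₐ[ℂ] Module.End ℂ (X → ℂ) :=
  AlgHom.ofLinearMap
    { toFun := permEnd d
      map_add' := fun a b => by
        refine LinearMap.ext fun f => funext fun x => ?_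
        simp [permEnd_apply, add_apply, add_mul, Finset.sum_add_distrib]
      map_smul' := fun c a => by
        refine LinearMap.ext fun f => funext fun x => ?_
        simp [permEnd_apply, smul_apply, Finset.mul_sum, mul_assoc] }
    (by
      refine LinearMap.ext fun f => funext fun x => ?_
      simp [permEnd_apply, one_apply])
    (permEnd_mul d hd)

/-- When distinct points have distinct degrees, `dual (d x)` projects onto the functions supported
at `x`. These elements therefore act as scaled matrix units, which is what forces simplicity on a
transitive `G`-set. -/
theorem permEnd_ofGroup_mul_dual_of_injective (hinj : Function.Injective d) [DecidableEq X]
    (c : ℂ) (g : G) (x : X) (f : X → ℂ) :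
    permEnd d (c • (ofGroup g * dual (d x))) f = Pi.single (g • x) (c * f x) := by
  funext y
  rw [permEnd_apply, Finset.sum_eq_single g]
  · simp only [smul_apply, ofGroup_mul_dual, basisElem, true_and, hinj.eq_iff]
    by_cases hy : y = g • x
    · subst hy
      simp
    · have : g⁻¹ • y ≠ x := fun h => hy (by rw [← h, smul_inv_smul])
      simp [hy, this]
  · intro k _ hk
    simp [smul_apply, ofGroup_mul_dual, basisElem, hk]
  · simp

/-- The functions on a single conjugacy class form a simple module. -/
theorem isSimpleModule_permRep (hd : ∀ (g : G) (x : X), d (g • x) = g * d x * g⁻¹)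
    (hinj : Function.Injective d) [Fintype X] [Nonempty X] [MulAction.IsPretransitive G X] :
    @IsSimpleModule (QuantumDouble G) _ (X → ℂ) _
      (Module.compHom (X → ℂ) (permRep d hd).toRingHom) := by
  classical
  let : Module (QuantumDouble G) (X → ℂ) := Module.compHom (X → ℂ) (permRep d hd).toRingHom
  have key : ∀ (c : ℂ) (g : G) (x : X) (f : X → ℂ),
      (c • (ofGroup g * dual (d x)) : QuantumDouble G) • f = Pi.single (g • x) (c * f x) :=
    permEnd_ofGroup_mul_dual_of_injective d hinj
  refine { exists_pair_ne := ⟨⊥, ⊤, bot_ne_top⟩, eq_bot_or_eq_top := fun N => ?_ }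
  refine or_iff_not_imp_left.mpr fun hN => ?_
  obtain ⟨f, hf, hf0⟩ := N.exists_mem_ne_zero_of_ne_bot hN
  obtain ⟨x, hx⟩ := Function.ne_iff.mp hf0
  rw [Submodule.eq_top_iff']
  intro f'
  rw [← Finset.univ_sum_single f']
  refine N.sum_mem fun y _ => ?_
  obtain ⟨g, rfl⟩ := MulAction.exists_smul_eq G x y
  -- The scalar turns the nonzero value of `f` at `x` into the required value of `f'` at `g • x`.
  have := N.smul_mem ((f' (g • x) * (f x)⁻¹) • (ofGroup g * dual (d x)) : QuantumDouble G) hf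
  rwa [key, mul_assoc, inv_mul_cancel₀ hx, mul_one] at this

end Permutation

section ConjugacyClass

variable {G : Type} [Group G] [Fintype G] [DecidableEq G]

/-- `G` acts on the conjugacy class of `c`. -/
@[reducible] def conjClassAction (c : G) : MulAction G {x : G // IsConj c x} where
  smul g x := ⟨g * x.1 * g⁻¹, x.2.trans (isConj_iff.mpr ⟨g, rfl⟩)⟩
  one_smul x := Subtype.ext (show 1 * x.1 * 1⁻¹ = x.1 by simp)
  mul_smul g k x := Subtype.ext (show g * k * x.1 * (g * k)⁻¹ = g * (k * x.1 * k⁻¹) * g⁻¹ by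
    simp [mul_assoc])

/-- The class of `c`, with its inclusion into `G` as degree map, is a transitive crossed `G`-set
with injective degree. `ULift` only moves the function space to the required universe. -/
theorem exists_simple_finrank_eq_card_conjClass (c : G) :
    ∃ (V : Type u) (_ : AddCommGroup V) (_ : Module ℂ V) (_ : Module (QuantumDouble G) V)
      (_ : IsScalarTower ℂ (QuantumDouble G) V),
      IsSimpleModule (QuantumDouble G) V ∧
        Module.finrank ℂ V = Fintype.card {x : G // IsConj c x} := by
  let := conjClassAction c
  let d : {x : G // IsConj c x} → G := Subtype.val
  have hd : ∀ (g : G) (x : {x : G // IsConj c x}), d (g • x) = g * d x * g⁻¹ := fun _ _ => rfl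
  have : Nonempty {x : G // IsConj c x} := ⟨⟨c, IsConj.refl c⟩⟩
  have : MulAction.IsPretransitive G {x : G // IsConj c x} := ⟨fun x y => by
    obtain ⟨g, hg⟩ := isConj_iff.mp (x.2.symm.trans y.2)
    exact ⟨g, Subtype.ext hg⟩⟩
  let : Module (QuantumDouble G) ({x : G // IsConj c x} → ℂ) :=
    Module.compHom _ (permRep d hd).toRingHom
  have : IsScalarTower ℂ (QuantumDouble G) ({x : G // IsConj c x} → ℂ) :=
    ⟨fun z a f => congrArg (fun T : Module.End ℂ _ => T f) (map_smul (permRep d hd) z a)⟩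
  have : IsSimpleModule (QuantumDouble G) ({x : G // IsConj c x} → ℂ) :=
    isSimpleModule_permRep d hd Subtype.val_injective
  refine ⟨ULift.{u} ({x : G // IsConj c x} → ℂ), inferInstance, inferInstance, inferInstance,
    inferInstance, ?_, ?_⟩
  · exact IsSimpleModule.congr (ULift.moduleEquiv (R := QuantumDouble G)
      (M := {x : G // IsConj c x} → ℂ))
  · rw [(ULift.moduleEquiv (R := ℂ) (M := {x : G // IsConj c x} → ℂ)).finrank_eq,
      Module.finrank_fintype_fun_eq_card]

end ConjugacyClass

theorem card_conjClass_sr_three :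
    Fintype.card {x : DihedralGroup 3 // IsConj (DihedralGroup.sr 0) x} = 3 := by
  decide +kernel

theorem card_conjClass_sr_six :
    Fintype.card {x : DihedralGroup 6 // IsConj (DihedralGroup.sr 0) x} = 3 := by
  decide +kernel

end QuantumDouble

/-! ### Classification for dihedral groups. -/

namespace QuantumDouble

open DihedralGroup

section Dihedral

variable {n : ℕ} [NeZero n] {V : Type*} [AddCommGroup V] [Module ℂ V]
  [Module (QuantumDouble (DihedralGroup n)) V]

/-- A basis adapted to a three-dimensional irreducible representation: `e k` has degree the
reflection `sr (i - 2 k)`, the rotation `r 1` permutes the `e k` cyclically up to the scalar `nu`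
by which `r 3` acts, and `lam` is the eigenvalue of `sr i` on `e 0`. -/
structure IsAdapted (e : Fin 3 → V) (i : ZMod n) (lam nu : ℂ) : Prop where
  lam_sign : lam = 1 ∨ lam = -1
  nu_sign : nu = 1 ∨ nu = -1
  r_zero : (ofGroup (r 1) : QuantumDouble (DihedralGroup n)) • e 0 = e 1
  r_one : (ofGroup (r 1) : QuantumDouble (DihedralGroup n)) • e 1 = e 2
  r_two : (ofGroup (r 1) : QuantumDouble (DihedralGroup n)) • e 2 = nu • e 0
  sr_zero : (ofGroup (sr i) : QuantumDouble (DihedralGroup n)) • e 0 = lam • e 0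
  degree : ∀ (k : Fin 3) (h : DihedralGroup n),
    (dual h : QuantumDouble (DihedralGroup n)) • e k =
      if h = sr (i - 2 * ((k : ℕ) : ZMod n)) then e k else 0

variable [IsScalarTower ℂ (QuantumDouble (DihedralGroup n)) V]

/-- An involution acting on a nonzero vector has an eigenvector among `x`, `x + T x`. -/
theorem exists_sign_eigenvector {a : QuantumDouble (DihedralGroup n)} {x : V} (hx : x ≠ 0)
    (ha : a • a • x = x) :
    ∃ (y : V) (c : ℂ), y ≠ 0 ∧ (c = 1 ∨ c = -1) ∧ a • y = c • y ∧ (y = x ∨ y = x + a • x) := by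
  by_cases h : x + a • x = 0
  · exact ⟨x, -1, hx, Or.inr rfl, by rw [neg_one_smul]; exact eq_neg_of_add_eq_zero_right h,
      Or.inl rfl⟩
  · exact ⟨x + a • x, 1, h, Or.inl rfl, by rw [smul_add, ha, one_smul, add_comm], Or.inr rfl⟩

/-- A vector of reflection degree can be chosen to be a joint eigenvector of the reflection and of
a central rotation of order at most two. -/
theorem exists_joint_eigenvector {i j : ZMod n} (hj : 2 * j = 0) {x : V} (hx : x ≠ 0)
    (hdeg : (dual (sr i) : QuantumDouble (DihedralGroup n)) • x = x) :
    ∃ (v : V) (lam nu : ℂ), v ≠ 0 ∧ (lam = 1 ∨ lam = -1) ∧ (nu = 1 ∨ nu = -1) ∧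
      (ofGroup (sr i) : QuantumDouble (DihedralGroup n)) • v = lam • v ∧
      (ofGroup (r j) : QuantumDouble (DihedralGroup n)) • v = nu • v ∧
      (dual (sr i) : QuantumDouble (DihedralGroup n)) • v = v := by
  have hjj : j + j = 0 := by rw [← two_mul, hj]
  obtain ⟨y, lam, hy, hlam, hsy, hyx⟩ := exists_sign_eigenvector
    (a := (ofGroup (sr i) : QuantumDouble (DihedralGroup n))) hx
    (by rw [ofGroup_smul_smul, sr_mul_self, ofGroup_one_smul])
  have hdy : (dual (sr i) : QuantumDouble (DihedralGroup n)) • y = y := by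
    rcases hyx with rfl | rfl
    · exact hdeg
    · rw [smul_add, hdeg, dual_smul_ofGroup_smul]
      simp [hdeg]
  obtain ⟨z, nu, hz, hnu, hrz, hzy⟩ := exists_sign_eigenvector
    (a := (ofGroup (r j) : QuantumDouble (DihedralGroup n))) hy
    (by rw [ofGroup_smul_smul, r_mul_r, hjj, r_zero, ofGroup_one_smul])
  refine ⟨z, lam, nu, hz, hlam, hnu, ?_, hrz, ?_⟩
  · rcases hzy with rfl | rfl
    · exact hsy
    -- Since `2 * j = 0`, `r j` commutes with `sr i`, so passing from `y` to `y + r j • y` keeps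
    -- both the eigenvalue `lam` and the degree.
    · have : (sr i * r j : DihedralGroup n) = r j * sr i := by
        rw [sr_mul_r, r_mul_sr, eq_sub_of_add_eq (show (i + j) + j = i by rw [add_assoc, hjj, add_zero])]
      rw [smul_add, ofGroup_smul_smul, this, ← ofGroup_smul_smul, hsy, smul_add,
        smul_comm lam]
  · rcases hzy with rfl | rfl
    · exact hdy
    · rw [smul_add, hdy, dual_smul_ofGroup_smul]
      have : ((r j)⁻¹ * sr i * r j : DihedralGroup n) = sr i := by
        rw [inv_r, r_mul_sr, sr_mul_r, sub_neg_eq_add, add_assoc, hjj, add_zero]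
      rw [this, hdy]

theorem r_smul_eq_pow_smul {v : V} {c : ℂ}
    (hv : (ofGroup (r 1) : QuantumDouble (DihedralGroup n)) • v = c • v) (j : ℕ) :
    (ofGroup (r (j : ZMod n)) : QuantumDouble (DihedralGroup n)) • v = c ^ j • v := by
  induction j with
  | zero => simp [ofGroup_one_smul, -r_zero, ← one_def]
  | succ j ih =>
    rw [Nat.cast_succ, ← r_mul_r, ← ofGroup_smul_smul, hv, smul_comm, ih, smul_smul, pow_succ']

/-- A simple module with a vector of rotation degree has dimension at most two. -/
theorem finrank_le_two_of_rotation_degree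
    [IsSimpleModule (QuantumDouble (DihedralGroup n)) V] [FiniteDimensional ℂ V]
    {i : ZMod n} {x : V} (hx : x ≠ 0)
    (hdeg : (dual (r i) : QuantumDouble (DihedralGroup n)) • x = x) :
    Module.finrank ℂ V ≤ 2 := by
  classical
  let D := rep (DihedralGroup n) V (dual (r i))
  let E : Submodule ℂ V := LinearMap.eqLocus D LinearMap.id
  have hE : ∀ y, y ∈ E ↔ (dual (r i) : QuantumDouble (DihedralGroup n)) • y = y := fun _ => Iff.rfl
  -- Rotations commute, so `r 1` preserves the component `E` of degree `r i` and has an eigenvector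
  -- in it.
  have hstab : ∀ y ∈ E, rep (DihedralGroup n) V (ofGroup (r 1)) y ∈ E := by
    intro y hy
    rw [hE] at hy ⊢
    change (dual (r i) : QuantumDouble (DihedralGroup n)) •
      (ofGroup (r 1) : QuantumDouble (DihedralGroup n)) • y = (ofGroup (r 1) : QuantumDouble (DihedralGroup n)) • y
    rw [dual_smul_ofGroup_smul]
    simp [hy]
  have : Nontrivial E := ⟨⟨⟨x, hdeg⟩, 0, fun h => hx (congrArg Subtype.val h)⟩⟩
  obtain ⟨c, hc⟩ := Module.End.exists_eigenvalue
    ((rep (DihedralGroup n) V (ofGroup (r 1))).restrict hstab)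
  obtain ⟨⟨v, hvE⟩, hv⟩ := hc.exists_hasEigenvector
  have hv0 : v ≠ 0 := fun h => hv.2 (Subtype.ext h)
  have hrv : (ofGroup (r 1) : QuantumDouble (DihedralGroup n)) • v = c • v :=
    congrArg Subtype.val hv.apply_eq_smul
  rw [hE] at hvE
  let w : V := (ofGroup (sr 0) : QuantumDouble (DihedralGroup n)) • v
  have hr : ∀ j : ZMod n, (ofGroup (r j) : QuantumDouble (DihedralGroup n)) • v =
      c ^ j.val • v := fun j => by
    rw [← r_smul_eq_pow_smul hrv, ZMod.natCast_zmod_val]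
  have hsr : ∀ j : ZMod n, (ofGroup (sr j) : QuantumDouble (DihedralGroup n)) • v =
      c ^ j.val • w := fun j => by
    have : (sr j : DihedralGroup n) = sr 0 * r j := by rw [sr_mul_r, zero_add]
    rw [this, ← ofGroup_smul_smul, hr, smul_comm]
  have hgv : ∀ g : DihedralGroup n,
      (ofGroup g : QuantumDouble (DihedralGroup n)) • v ∈ Submodule.span ℂ {v, w} := by
    rintro (j | j)
    · rw [hr]
      exact Submodule.smul_mem _ _ (Submodule.subset_span (by simp))
    · rw [hsr]
      exact Submodule.smul_mem _ _ (Submodule.subset_span (by simp))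
  have hdv := dual_smul_of_fixed (G := DihedralGroup n) hvE
  have hdw := dual_smul_ofGroup_smul_of_degree hdv (sr 0)
  -- Rotations scale `v`, reflections send it to multiples of `w`, and both vectors are homogeneous;
  -- since `w` is itself a translate of `v`, the span is stable.
  have htop : Submodule.span ℂ {v, w} = ⊤ := by
    refine eq_top_of_stable (G := DihedralGroup n) _ (fun g y hy => ?_) (fun h y hy => ?_)
      (Submodule.subset_span (Set.mem_insert v {w})) hv0
    · obtain ⟨s, t, rfl⟩ := Submodule.mem_span_pair.mp hy
      rw [smul_add, smul_comm, smul_comm (ofGroup g : QuantumDouble (DihedralGroup n)) t, ofGroup_smul_smul]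
      exact add_mem (Submodule.smul_mem _ _ (hgv _)) (Submodule.smul_mem _ _ (hgv _))
    · obtain ⟨s, t, rfl⟩ := Submodule.mem_span_pair.mp hy
      rw [smul_add, smul_comm, smul_comm (dual h : QuantumDouble (DihedralGroup n)) t, hdv, hdw]
      refine add_mem (Submodule.smul_mem _ _ ?_) (Submodule.smul_mem _ _ ?_)
      · split_ifs
        exacts [Submodule.subset_span (by simp), zero_mem _]
      · split_ifs
        exacts [Submodule.subset_span (by simp [w]), zero_mem _]
  rw [← finrank_top ℂ V, ← htop]
  calc Module.finrank ℂ (Submodule.span ℂ {v, w})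
      = Module.finrank ℂ (Submodule.span ℂ (({v, w} : Finset V) : Set V)) := by rw [Finset.coe_pair]
    _ ≤ ({v, w} : Finset V).card := finrank_span_finset_le_card _
    _ ≤ 2 := Finset.card_le_two

/-- If `m` is the order of `2` in `ℤ/n` (additively), a simple module with a vector of reflection
degree has as a basis the translates of a joint eigenvector by the first `m` rotations. -/
theorem exists_basis_of_reflection_degree
    [IsSimpleModule (QuantumDouble (DihedralGroup n)) V] {m : ℕ} (hm0 : 0 < m)
    (hm : (2 * m : ZMod n) = 0)
    (hinj : ∀ j k : Fin m, (2 * (j : ℕ) : ZMod n) = 2 * (k : ℕ) → j = k)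
    {i : ZMod n} {x : V} (hx : x ≠ 0)
    (hdeg : (dual (sr i) : QuantumDouble (DihedralGroup n)) • x = x) :
    ∃ (e : Module.Basis (Fin m) ℂ V) (v : V) (lam nu : ℂ), v ≠ 0 ∧ (lam = 1 ∨ lam = -1) ∧
      (nu = 1 ∨ nu = -1) ∧ (ofGroup (sr i) : QuantumDouble (DihedralGroup n)) • v = lam • v ∧
      (ofGroup (r (m : ZMod n)) : QuantumDouble (DihedralGroup n)) • v = nu • v ∧
      (∀ k, e k = (ofGroup (r ((k : ℕ) : ZMod n)) : QuantumDouble (DihedralGroup n)) • v) ∧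
      (∀ (k : Fin m) (h : DihedralGroup n), (dual h : QuantumDouble (DihedralGroup n)) • e k =
        if h = sr (i - 2 * ((k : ℕ) : ZMod n)) then e k else 0) := by
  obtain ⟨v, lam, nu, hv, hlam, hnu, hsv, hrv, hdv⟩ := exists_joint_eigenvector hm hx hdeg
  let f : Fin m → V := fun k =>
    (ofGroup (r ((k : ℕ) : ZMod n)) : QuantumDouble (DihedralGroup n)) • v
  have hrdeg : ∀ (j : ZMod n) (h : DihedralGroup n), (dual h : QuantumDouble (DihedralGroup n)) •
      (ofGroup (r j) : QuantumDouble (DihedralGroup n)) • v =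
        if h = sr (i - 2 * j) then (ofGroup (r j) : QuantumDouble (DihedralGroup n)) • v else 0 := by
    intro j h
    rw [dual_smul_ofGroup_smul_of_degree (dual_smul_of_fixed (G := DihedralGroup n) hdv)]
    rw [r_mul_sr, inv_r, sr_mul_r, two_mul, ← sub_eq_add_neg, sub_sub]
  have hfdeg : ∀ (k : Fin m) (h : DihedralGroup n),
      (dual h : QuantumDouble (DihedralGroup n)) • f k =
        if h = sr (i - 2 * ((k : ℕ) : ZMod n)) then f k else 0 := fun k => hrdeg _
  have hf0 : ∀ k, f k ≠ 0 := fun k h => hv (by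
    have := congrArg
      ((ofGroup (r (-((k : ℕ) : ZMod n))) : QuantumDouble (DihedralGroup n)) • ·) h
    simpa [f, ofGroup_smul_smul, ofGroup_one_smul, ← one_def, -r_zero] using this)
  -- By `hinj` the translates have distinct degrees, so projecting a relation onto one degree
  -- isolates one coefficient.
  have hli : LinearIndependent ℂ f := by
    rw [Fintype.linearIndependent_iff]
    intro c hc k
    have := congrArg
      ((dual (sr (i - 2 * ((k : ℕ) : ZMod n))) : QuantumDouble (DihedralGroup n)) • ·) hc
    simp only [Finset.smul_sum, smul_comm _ (c _), hfdeg, smul_zero] at this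
    rw [Finset.sum_eq_single k] at this
    · simpa [hf0 k] using this
    · intro j _ hjk
      rw [if_neg, smul_zero]
      intro h
      rw [sr.injEq, sub_right_inj] at h
      exact hjk (hinj _ _ h.symm)
    · simp
  -- The eigenvalue of `r m` on `v` lowers the exponent by `m` until it is below `m`.
  have hmem : ∀ j : ℕ, (ofGroup (r (j : ZMod n)) : QuantumDouble (DihedralGroup n)) • v ∈
      Submodule.span ℂ (Set.range f) := by
    intro j
    induction j using Nat.strong_induction_on with
    | _ j ih =>
      by_cases hj : j < m
      · exact Submodule.subset_span ⟨⟨j, hj⟩, rfl⟩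
      · obtain ⟨t, rfl⟩ := Nat.exists_eq_add_of_le' (not_lt.mp hj)
        rw [Nat.cast_add, ← r_mul_r, ← ofGroup_smul_smul, hrv, smul_comm]
        exact Submodule.smul_mem _ _ (ih t (by omega))
  have hmem' : ∀ j : ZMod n, (ofGroup (r j) : QuantumDouble (DihedralGroup n)) • v ∈
      Submodule.span ℂ (Set.range f) := fun j => by
    have := hmem j.val
    rwa [ZMod.natCast_zmod_val] at this
  have hgv : ∀ g : DihedralGroup n, (ofGroup g : QuantumDouble (DihedralGroup n)) • v ∈
      Submodule.span ℂ (Set.range f) := by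
    rintro (j | j)
    · exact hmem' j
    -- Every reflection is a rotation times `sr i`, and `sr i` only scales `v`.
    · have : (sr j : DihedralGroup n) = r (i - j) * sr i := by rw [r_mul_sr, sub_sub_cancel]
      rw [this, ← ofGroup_smul_smul, hsv, smul_comm]
      exact Submodule.smul_mem _ _ (hmem' _)
  have htop : Submodule.span ℂ (Set.range f) = ⊤ := by
    have h0 : f ⟨0, hm0⟩ ∈ Submodule.span ℂ (Set.range f) := Submodule.subset_span ⟨_, rfl⟩
    refine eq_top_of_stable (G := DihedralGroup n) _ (fun g y hy => ?_) (fun h y hy => ?_)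
      h0 (hf0 _)
    · induction hy using Submodule.span_induction with
      | mem y hy =>
        obtain ⟨k, rfl⟩ := hy
        simp only [f, ofGroup_smul_smul]
        exact hgv _
      | zero => rw [smul_zero]; exact zero_mem _
      | add y z _ _ hy hz => rw [smul_add]; exact add_mem hy hz
      | smul c y _ hy => rw [smul_comm]; exact Submodule.smul_mem _ _ hy
    · induction hy using Submodule.span_induction with
      | mem y hy =>
        obtain ⟨k, rfl⟩ := hy
        rw [hfdeg]
        split_ifs
        exacts [Submodule.subset_span ⟨k, rfl⟩, zero_mem _]
      | zero => rw [smul_zero]; exact zero_mem _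
      | add y z _ _ hy hz => rw [smul_add]; exact add_mem hy hz
      | smul c y _ hy => rw [smul_comm]; exact Submodule.smul_mem _ _ hy
  refine ⟨Module.Basis.mk hli htop.ge, v, lam, nu, hv, hlam, hnu, hsv, hrv, fun k => ?_,
    fun k h => ?_⟩
  · rw [Module.Basis.mk_apply]
  · rw [Module.Basis.mk_apply, hfdeg]

/-- The number `m` is the additive order of `2`, hence the size of a class of reflections: `n / 2`
for even `n`, and `n` for odd `n`, where `2` can be cancelled. -/
theorem exists_half_order (n : ℕ) [NeZero n] : ∃ m : ℕ, 0 < m ∧ (2 * m : ZMod n) = 0 ∧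
    (∀ j k : Fin m, (2 * (j : ℕ) : ZMod n) = 2 * (k : ℕ) → j = k) ∧ (m = n ∨ 2 * m = n) := by
  have hn := NeZero.pos n
  have red : ∀ a b : ℕ, (2 * a : ZMod n) = 2 * b ↔ 2 * a ≡ 2 * b [MOD n] := fun a b => by
    rw [← ZMod.natCast_eq_natCast_iff]
    push_cast
    rfl
  rcases Nat.even_or_odd' n with ⟨m, hm | hm⟩
  · refine ⟨m, by omega, ?_, fun j k h => ?_, Or.inr hm.symm⟩
    · have : ((2 * m : ℕ) : ZMod n) = 0 := by rw [← hm, ZMod.natCast_self]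
      exact_mod_cast this
    · rw [red] at h
      have := Nat.ModEq.eq_of_lt_of_lt h (by omega) (by omega)
      exact Fin.ext (by omega)
  · refine ⟨n, hn, by simp, fun j k h => ?_, Or.inl rfl⟩
    rw [red] at h
    have h2 : Nat.gcd n 2 = 1 := by
      rw [hm]
      simp
    exact Fin.ext (Nat.ModEq.eq_of_lt_of_lt (Nat.ModEq.cancel_left_of_coprime h2 h) j.2 k.2)

/-- The classification of the three-dimensional irreducible representations of `D(D_n)`. -/
theorem exists_adapted_basis (hV : IsSimpleModule (QuantumDouble (DihedralGroup n)) V)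
    (h3 : Module.finrank ℂ V = 3) :
    (n = 3 ∨ n = 6) ∧ ∃ (e : Module.Basis (Fin 3) ℂ V) (i : ZMod n) (lam nu : ℂ),
      IsAdapted (e : Fin 3 → V) i lam nu ∧ (n = 3 → nu = 1) := by
  have : FiniteDimensional ℂ V := Module.finite_of_finrank_pos (by omega)
  have : Nontrivial V := IsSimpleModule.nontrivial (QuantumDouble (DihedralGroup n)) V
  obtain ⟨h | i, x, hx, hdeg⟩ := exists_dual_smul_eq_self (G := DihedralGroup n) (V := V)
  · have := finrank_le_two_of_rotation_degree hx hdeg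
    omega
  · obtain ⟨m, hm0, hm, hinj, hmn⟩ := exists_half_order n
    obtain ⟨e, v, lam, nu, hv, hlam, hnu, hsv, hrv, he, hed⟩ :=
      exists_basis_of_reflection_degree hm0 hm hinj hx hdeg
    -- The basis has `m` elements, so the dimension determines `m`, and `hmn` then leaves only `n =
    -- 3` and `n = 6`.
    obtain rfl : m = 3 := by
      rw [← h3, Module.finrank_eq_card_basis e, Fintype.card_fin]
    refine ⟨by omega, e, i, lam, nu, ?_, ?_⟩
    · have e0 : e 0 = v := by
        rw [he]
        simp [ofGroup_one_smul, ← one_def, -r_zero]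
      have step : ∀ j k : ZMod n, (ofGroup (r j) : QuantumDouble (DihedralGroup n)) •
          (ofGroup (r k) : QuantumDouble (DihedralGroup n)) • v =
          (ofGroup (r (j + k)) : QuantumDouble (DihedralGroup n)) • v := fun j k => by
        rw [ofGroup_smul_smul, r_mul_r]
      exact
        { lam_sign := hlam
          nu_sign := hnu
          r_zero := by rw [e0, he]; simp
          r_one := by
            rw [he, he, step]
            norm_num
          r_two := by
            rw [he, step, e0, ← hrv]
            norm_num
          sr_zero := by rw [e0, hsv]
          degree := hed }
    -- For `n = 3` the rotation by `3` is the identity, so its eigenvalue is `1`.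
    · rintro rfl
      have h0 : ((3 : ℕ) : ZMod 3) = 0 := ZMod.natCast_self 3
      rw [h0, r_zero, ofGroup_one_smul] at hrv
      have : (nu - 1) • v = 0 := by rw [sub_smul, ← hrv, one_smul, sub_self]
      exact sub_eq_zero.mp ((smul_eq_zero.mp this).resolve_right hv)

end Dihedral

end QuantumDouble

/-! ### The action and `Ř` in an adapted basis. -/

namespace QuantumDouble

open DihedralGroup

section AdaptedBasis

variable {n : ℕ} [NeZero n] {V : Type*} [AddCommGroup V] [Module ℂ V]
  [Module (QuantumDouble (DihedralGroup n)) V] [IsScalarTower ℂ (QuantumDouble (DihedralGroup n)) V]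
  {i : ZMod n} {lam nu : ℂ}

/-- The signs which absorb `nu` into an adapted basis. -/
def adaptedSign (nu : ℂ) : Fin 3 → ℂ := ![1, nu, 1]

theorem adaptedSign_mul_self (hnu : nu = 1 ∨ nu = -1) (j : Fin 3) :
    adaptedSign nu j * adaptedSign nu j = 1 := by
  rcases hnu with rfl | rfl <;> fin_cases j <;> simp [adaptedSign]

namespace IsAdapted

theorem nu_mul_self {e : Fin 3 → V} (he : IsAdapted e i lam nu) : nu * nu = 1 := by
  rcases he.nu_sign with h | h <;> simp [h]

theorem sr_sub_one_smul (x : V) (j : ZMod n) :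
    (ofGroup (sr (j - 1)) : QuantumDouble (DihedralGroup n)) • x =
      (ofGroup (r 1) : QuantumDouble (DihedralGroup n)) •
        (ofGroup (sr j) : QuantumDouble (DihedralGroup n)) • x := by
  rw [ofGroup_smul_smul, r_mul_sr]

theorem sr_smul_r {x : V} (j : ZMod n) :
    (ofGroup (sr j) : QuantumDouble (DihedralGroup n)) •
        (ofGroup (r 1) : QuantumDouble (DihedralGroup n)) • x =
      (ofGroup (r (-1)) : QuantumDouble (DihedralGroup n)) •
        (ofGroup (sr j) : QuantumDouble (DihedralGroup n)) • x := by
  rw [ofGroup_smul_smul, ofGroup_smul_smul, r_mul_sr, sr_mul_r, sub_neg_eq_add]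

theorem r_neg_one_smul_r (x : V) :
    (ofGroup (r (-1)) : QuantumDouble (DihedralGroup n)) •
        (ofGroup (r 1) : QuantumDouble (DihedralGroup n)) • x = x := by
  rw [ofGroup_smul_smul, r_mul_r, neg_add_cancel, DihedralGroup.r_zero, ofGroup_one_smul]

theorem r_neg_one_zero {e : Fin 3 → V} (he : IsAdapted e i lam nu) :
    (ofGroup (r (-1)) : QuantumDouble (DihedralGroup n)) • e 0 = nu • e 2 := by
  have h := congrArg ((nu • (ofGroup (r (-1))) : QuantumDouble (DihedralGroup n)) • ·) he.r_two
  simp only [smul_assoc, r_neg_one_smul_r] at h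
  rw [smul_comm _ nu, smul_smul, he.nu_mul_self, one_smul] at h
  exact h.symm

theorem sr_one {e : Fin 3 → V} (he : IsAdapted e i lam nu) :
    (ofGroup (sr i) : QuantumDouble (DihedralGroup n)) • e 1 = (lam * nu) • e 2 := by
  rw [← he.r_zero, sr_smul_r, he.sr_zero, smul_comm, he.r_neg_one_zero, smul_smul]

theorem sr_two {e : Fin 3 → V} (he : IsAdapted e i lam nu) :
    (ofGroup (sr i) : QuantumDouble (DihedralGroup n)) • e 2 = (lam * nu) • e 1 := by
  rw [← he.r_one, sr_smul_r, he.sr_one, smul_comm, ← he.r_one, r_neg_one_smul_r]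

/-- The reflection which is the degree of `e k` reflects the indices about `k`. -/
theorem reflection {e : Fin 3 → V} (he : IsAdapted e i lam nu) (j k : Fin 3) :
    (ofGroup (sr (i - 2 * ((k : ℕ) : ZMod n))) : QuantumDouble (DihedralGroup n)) • e j =
      (lam * (adaptedSign nu j * adaptedSign nu (2 * k - j))) • e (2 * k - j) := by
  -- Written this way, `sr (i - 2 * k)` unfolds into `2 * k` applications of `r 1` after `sr i`,
  -- whose effect on the basis is known.
  have h0 : (i - 2 * ((0 : ℕ) : ZMod n)) = i := by simp
  have h1 : (i - 2 * ((1 : ℕ) : ZMod n)) = i - 1 - 1 := by push_cast; ring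
  have h2 : (i - 2 * ((2 : ℕ) : ZMod n)) = i - 1 - 1 - 1 - 1 := by push_cast; ring
  have hnn : ∀ x : V, nu • nu • x = x := fun x => by rw [smul_smul, he.nu_mul_self, one_smul]
  have hcomm : ∀ (g : DihedralGroup n) (c : ℂ) (x : V),
      (ofGroup g : QuantumDouble (DihedralGroup n)) • c • x =
        c • (ofGroup g : QuantumDouble (DihedralGroup n)) • x := fun _ _ _ => smul_comm _ _ _
  have neg1 : (-1 : Fin 3) = 2 := rfl
  have neg2 : (-2 : Fin 3) = 1 := rfl
  fin_cases k
  · simp only [Fin.zero_eta, h0]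
    fin_cases j <;> simp [neg1, neg2, he.sr_zero, he.sr_one, he.sr_two, adaptedSign]
  · simp only [Fin.mk_one, h1, sr_sub_one_smul]
    fin_cases j <;>
      simp [he.sr_zero, he.sr_one, he.sr_two, hcomm, he.r_zero, he.r_one,
        he.r_two, adaptedSign, mul_smul, hnn]
  · simp only [Fin.reduceFinMk, h2, sr_sub_one_smul]
    fin_cases j <;>
      simp [he.sr_zero, he.sr_one, he.sr_two, hcomm, he.r_zero, he.r_one,
        he.r_two, adaptedSign, mul_smul, hnn]

/-- The degree of `e k` is a reflection acting on indices by `j ↦ 2 * k - j`, so up to signs this is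
the quandle braiding. -/
theorem Rcheck_tmul {e : Fin 3 → V} (he : IsAdapted e i lam nu) (j k : Fin 3) :
    Rcheck (DihedralGroup n) V (e j ⊗ₜ e k) =
      (lam * (adaptedSign nu j * adaptedSign nu (2 * k - j))) • (e k ⊗ₜ[ℂ] e (2 * k - j)) := by
  rw [Rcheck_tmul_of_degree (he.degree k), he.reflection, TensorProduct.tmul_smul]

/-- After absorbing signs and rescaling, `Ř` is the reflection braiding up to the sign `lam`. -/
theorem Rcheck_tmul_smul {e : Fin 3 → V} (he : IsAdapted e i lam nu) (t : ℂ) (j k : Fin 3) :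
    Rcheck (DihedralGroup n) V
        (((adaptedSign nu j * t) • e j) ⊗ₜ ((adaptedSign nu k * t) • e k)) =
      lam • (((adaptedSign nu k * t) • e k) ⊗ₜ[ℂ]
        ((adaptedSign nu (2 * k - j) * t) • e (2 * k - j))) := by
  rw [TensorProduct.smul_tmul_smul, TensorProduct.smul_tmul_smul, map_smul, he.Rcheck_tmul,
    smul_smul, smul_smul]
  congr 1
  linear_combination (lam * t * t * adaptedSign nu k * adaptedSign nu (2 * k - j)) *
    adaptedSign_mul_self he.nu_sign j

variable {e : Module.Basis (Fin 3) ℂ V}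

theorem toMatrix_r_one (he : IsAdapted (e : Fin 3 → V) i lam nu) :
    LinearMap.toMatrix e e (rep (DihedralGroup n) V (ofGroup (r 1))) =
      !![0, 0, nu; 1, 0, 0; 0, 1, 0] := by
  ext p q
  rw [LinearMap.toMatrix_apply]
  change e.repr ((ofGroup (r 1) : QuantumDouble (DihedralGroup n)) • e q) p = _
  fin_cases q
  · simp only [Fin.zero_eta, he.r_zero, Module.Basis.repr_self]
    fin_cases p <;> simp
  · simp only [Fin.mk_one, he.r_one, Module.Basis.repr_self]
    fin_cases p <;> simp
  · simp only [Fin.reduceFinMk, he.r_two, map_smul, Module.Basis.repr_self]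
    fin_cases p <;> simp

theorem toMatrix_sr (he : IsAdapted (e : Fin 3 → V) i lam nu) :
    LinearMap.toMatrix e e (rep (DihedralGroup n) V (ofGroup (sr i))) =
      !![lam, 0, 0; 0, 0, lam * nu; 0, lam * nu, 0] := by
  ext p q
  rw [LinearMap.toMatrix_apply]
  change e.repr ((ofGroup (sr i) : QuantumDouble (DihedralGroup n)) • e q) p = _
  fin_cases q
  · simp only [Fin.zero_eta, he.sr_zero, map_smul, Module.Basis.repr_self]
    fin_cases p <;> simp
  · simp only [Fin.mk_one, he.sr_one, map_smul, Module.Basis.repr_self]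
    fin_cases p <;> simp
  · simp only [Fin.reduceFinMk, he.sr_two, map_smul, Module.Basis.repr_self]
    fin_cases p <;> simp

/-- The generators `r 1` and `sr i` act by signed permutation matrices, and every group element is a
power of `r 1`, possibly times `sr i`. -/
theorem toMatrix_mem_unitaryGroup (he : IsAdapted (e : Fin 3 → V) i lam nu)
    (g : DihedralGroup n) :
    LinearMap.toMatrix e e (rep (DihedralGroup n) V (ofGroup g)) ∈
      Matrix.unitaryGroup (Fin 3) ℂ := by
  have hmul : ∀ g k : DihedralGroup n,
      LinearMap.toMatrix e e (rep (DihedralGroup n) V (ofGroup (g * k))) =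
        LinearMap.toMatrix e e (rep (DihedralGroup n) V (ofGroup g)) *
          LinearMap.toMatrix e e (rep (DihedralGroup n) V (ofGroup k)) := fun g k => by
    rw [ofGroup_mul, map_mul, LinearMap.toMatrix_mul]
  have hr1 : LinearMap.toMatrix e e (rep (DihedralGroup n) V (ofGroup (r 1))) ∈
      Matrix.unitaryGroup (Fin 3) ℂ := by
    rw [he.toMatrix_r_one, Matrix.mem_unitaryGroup_iff]
    ext p q
    rcases he.nu_sign with rfl | rfl <;> fin_cases p <;> fin_cases q <;>
      simp [Matrix.mul_apply, Fin.sum_univ_three, Matrix.star_apply]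
  have hs : LinearMap.toMatrix e e (rep (DihedralGroup n) V (ofGroup (sr i))) ∈
      Matrix.unitaryGroup (Fin 3) ℂ := by
    rw [he.toMatrix_sr, Matrix.mem_unitaryGroup_iff]
    ext p q
    rcases he.nu_sign with rfl | rfl <;> rcases he.lam_sign with rfl | rfl <;> fin_cases p <;>
      fin_cases q <;> simp [Matrix.mul_apply, Fin.sum_univ_three, Matrix.star_apply]
  have hr : ∀ j : ℕ, LinearMap.toMatrix e e
      (rep (DihedralGroup n) V (ofGroup (r (j : ZMod n)))) ∈ Matrix.unitaryGroup (Fin 3) ℂ := by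
    intro j
    induction j with
    | zero =>
      rw [Nat.cast_zero, DihedralGroup.r_zero, ofGroup_one, map_one, LinearMap.toMatrix_one]
      exact one_mem _
    | succ j ih =>
      rw [Nat.cast_succ, ← r_mul_r, hmul]
      exact mul_mem ih hr1
  have hr' : ∀ j : ZMod n, LinearMap.toMatrix e e
      (rep (DihedralGroup n) V (ofGroup (r j))) ∈ Matrix.unitaryGroup (Fin 3) ℂ := fun j => by
    have := hr j.val
    rwa [ZMod.natCast_zmod_val] at this
  obtain j | j := g
  · exact hr' j
  · have : (sr j : DihedralGroup n) = r (i - j) * sr i := by rw [r_mul_sr, sub_sub_cancel]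
    rw [this, hmul]
    exact mul_mem (hr' _) hs

theorem toMatrix_dual (he : IsAdapted (e : Fin 3 → V) i lam nu) (h : DihedralGroup n) :
    LinearMap.toMatrix e e (rep (DihedralGroup n) V (dual h)) =
      Matrix.diagonal fun k : Fin 3 => if h = sr (i - 2 * ((k : ℕ) : ZMod n)) then 1 else 0 := by
  ext p q
  rw [LinearMap.toMatrix_apply]
  change e.repr ((dual h : QuantumDouble (DihedralGroup n)) • e q) p = _
  rw [he.degree]
  by_cases hq : p = q
  · subst hq
    rw [Matrix.diagonal_apply_eq]
    split_ifs <;> simp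
  · rw [Matrix.diagonal_apply_ne _ hq]
    split_ifs <;> simp [Ne.symm hq]

theorem isHermitian_toMatrix_dual (he : IsAdapted (e : Fin 3 → V) i lam nu)
    (h : DihedralGroup n) :
    (LinearMap.toMatrix e e (rep (DihedralGroup n) V (dual h))).IsHermitian := by
  rw [he.toMatrix_dual]
  refine Matrix.isHermitian_diagonal_of_self_adjoint _ (funext fun k => ?_)
  simp only [Pi.star_apply]
  split_ifs <;> simp

/-- Going once around the cycle of basis vectors picks up `nu` exactly once, wherever it starts. -/
theorem rep_r_three (he : IsAdapted (e : Fin 3 → V) i lam nu) :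
    rep (DihedralGroup n) V (ofGroup (r 3)) = nu • LinearMap.id := by
  have h3 : (r 3 : DihedralGroup n) = r 1 * (r 1 * r 1) := by
    rw [r_mul_r, r_mul_r]
    norm_num
  refine e.ext fun k => ?_
  change (ofGroup (r 3) : QuantumDouble (DihedralGroup n)) • e k = nu • e k
  rw [h3, ← ofGroup_smul_smul, ← ofGroup_smul_smul]
  fin_cases k <;> simp [he.r_zero, he.r_one, he.r_two, smul_comm _ nu]

/-- Each column has a single nonzero entry. It carries `nu` exactly when one of `j` and `2 * k - j`,
but not both, is the middle index. -/
theorem toMatrix_Rcheck (he : IsAdapted (e : Fin 3 → V) i lam nu) {a b : ℕ}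
    (ha : nu = (-1) ^ a) (hb : lam = (-1) ^ b) :
    LinearMap.toMatrix (ThreeDim.tensorBasis e) (ThreeDim.tensorBasis e)
      (Rcheck (DihedralGroup n) V) = ThreeDim.RcheckMatrix a b := by
  have hB : ∀ j k, ThreeDim.tensorBasis e (ThreeDim.pairOrder (j, k)) = e j ⊗ₜ e k := by
    intro j k
    simp [ThreeDim.tensorBasis]
  have hcol : ∀ j k, Rcheck (DihedralGroup n) V
      (ThreeDim.tensorBasis e (ThreeDim.pairOrder (j, k))) =
      (lam * (adaptedSign nu j * adaptedSign nu (2 * k - j))) •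
        ThreeDim.tensorBasis e (ThreeDim.pairOrder (k, 2 * k - j)) := by
    intro j k
    rw [hB, hB, he.Rcheck_tmul]
  ext p q
  obtain ⟨⟨j, k⟩, rfl⟩ := ThreeDim.pairOrder.surjective q
  rw [LinearMap.toMatrix_apply, hcol, map_smul, Module.Basis.repr_self, Finsupp.smul_apply,
    Finsupp.single_apply, ThreeDim.RcheckMatrix, Matrix.smul_apply, ← hb, ← ha, smul_eq_mul,
    smul_eq_mul, mul_assoc]
  congr 1
  have neg1 : (-1 : Fin 3) = 2 := rfl
  have neg2 : (-2 : Fin 3) = 1 := rfl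
  fin_cases j <;> fin_cases k <;> fin_cases p <;>
    simp [neg1, neg2, adaptedSign, ThreeDim.pairOrder, finProdFinEquiv, he.nu_mul_self]

end IsAdapted

end AdaptedBasis

end QuantumDouble

/-! ### Orthonormal bases in unitary representations. -/

namespace QuantumDouble

open DihedralGroup

section Unitary

variable {n : ℕ} [NeZero n] {V : Type*} [NormedAddCommGroup V] [InnerProductSpace ℂ V]
  [Module (QuantumDouble (DihedralGroup n)) V] [IsScalarTower ℂ (QuantumDouble (DihedralGroup n)) V]
  {i : ZMod n} {lam nu : ℂ}

theorem IsUnitaryAction.norm_ofGroup_smul (hV : IsUnitaryAction (DihedralGroup n) V)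
    (g : DihedralGroup n) (x : V) :
    ‖(ofGroup g : QuantumDouble (DihedralGroup n)) • x‖ = ‖x‖ := by
  rw [@norm_eq_sqrt_re_inner ℂ, hV.inner_ofGroup, ← @norm_eq_sqrt_re_inner ℂ]

/-- In a unitary representation an adapted basis is orthogonal, with all vectors of the same
length. -/
theorem IsAdapted.orthonormal_smul {e : Fin 3 → V} (he : IsAdapted e i lam nu)
    (hn : n = 3 ∨ n = 6) (hV : IsUnitaryAction (DihedralGroup n) V) (h0 : e 0 ≠ 0) :
    Orthonormal ℂ fun k => (adaptedSign nu k * ((‖e 0‖⁻¹ : ℝ) : ℂ)) • e k := by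
  have hinj : ∀ j k : Fin 3, (2 * ((j : ℕ) : ZMod n)) = 2 * ((k : ℕ) : ZMod n) → j = k := by
    rcases hn with rfl | rfl <;> decide
  have hnorm1 : ‖e 1‖ = ‖e 0‖ := by rw [← he.r_zero, hV.norm_ofGroup_smul]
  have hnorm2 : ‖e 2‖ = ‖e 0‖ := by rw [← he.r_one, hV.norm_ofGroup_smul, hnorm1]
  have hnorm : ∀ k, ‖e k‖ = ‖e 0‖ := fun k => by
    fin_cases k
    exacts [rfl, hnorm1, hnorm2]
  have hsign : ∀ k, ‖adaptedSign nu k‖ = 1 := fun k => by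
    rcases he.nu_sign with rfl | rfl <;> fin_cases k <;> simp [adaptedSign]
  refine ⟨fun k => ?_, fun j k hjk => ?_⟩
  · rw [norm_smul, norm_mul, hsign, one_mul, Complex.norm_real, norm_inv, norm_norm, hnorm k,
      inv_mul_cancel₀ (norm_ne_zero_iff.mpr h0)]
  -- The self-adjoint projection onto the degree of `e j` fixes `e j` and kills `e k`.
  · have h := hV.inner_dual (sr (i - 2 * ((j : ℕ) : ZMod n))) (e j) (e k)
    rw [he.degree, if_pos rfl, he.degree, if_neg, inner_zero_right] at h
    · simp only [inner_smul_left, inner_smul_right, h, mul_zero]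
    · intro hh
      rw [sr.injEq, sub_right_inj] at hh
      exact hjk (hinj _ _ hh)

/-- A unitary three-dimensional irreducible representation has an orthonormal basis in which `Ř` is
the reflection braiding up to sign. -/
theorem exists_orthonormalBasis_Rcheck (hS : IsSimpleModule (QuantumDouble (DihedralGroup n)) V)
    (h3 : Module.finrank ℂ V = 3) (hV : IsUnitaryAction (DihedralGroup n) V) :
    ∃ (f : OrthonormalBasis (Fin 3) ℂ V) (c : ℂ), (c = 1 ∨ c = -1) ∧ ∀ j k,
      Rcheck (DihedralGroup n) V (f j ⊗ₜ f k) = c • (f k ⊗ₜ[ℂ] f (2 * k - j)) := by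
  obtain ⟨hn, e, i, lam, nu, he, -⟩ := exists_adapted_basis hS h3
  have hon := he.orthonormal_smul hn hV (e.ne_zero 0)
  let b := basisOfOrthonormalOfCardEqFinrank hon (by rw [h3, Fintype.card_fin])
  have hb : (b : Fin 3 → V) = _ := coe_basisOfOrthonormalOfCardEqFinrank hon _
  refine ⟨b.toOrthonormalBasis (by rw [hb]; exact hon), lam, he.lam_sign, fun j k => ?_⟩
  simp only [Module.Basis.coe_toOrthonormalBasis, hb]
  exact he.Rcheck_tmul_smul _ j k

end Unitary

end QuantumDouble

/-! ### Equivalence of the displayed matrices. -/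

namespace ThreeDim

/-- The conjugating matrix is the diagonal of `adaptedSign` at `nu = -1`, the rescaling that absorbs
`nu`. -/
theorem exists_unitary_conj_RcheckMatrix (b : ℕ) : ∃ U ∈ Matrix.unitaryGroup (Fin 3) ℂ,
    tensorSquare U * RcheckMatrix 0 b * (tensorSquare U).conjTranspose = RcheckMatrix 1 b := by
  have hU : tensorSquare (Matrix.diagonal ![1, -1, 1]) =
      Matrix.diagonal ![1, -1, 1, -1, 1, -1, 1, -1, 1] := by
    rw [tensorSquare, Matrix.diagonal_kronecker_diagonal, Matrix.reindex_apply,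
      Matrix.submatrix_diagonal_equiv]
    congr 1
    funext p
    obtain ⟨q, rfl⟩ := pairOrder.surjective p
    rw [Function.comp_apply, Equiv.symm_apply_apply]
    obtain ⟨j, k⟩ := q
    fin_cases j <;> fin_cases k <;> simp [pairOrder, finProdFinEquiv]
  refine ⟨Matrix.diagonal ![1, -1, 1], ?_, ?_⟩
  · rw [Matrix.mem_unitaryGroup_iff, Matrix.star_eq_conjTranspose, Matrix.diagonal_conjTranspose,
      Matrix.diagonal_mul_diagonal, ← Matrix.diagonal_one]
    congr 1
    funext k
    fin_cases k <;> simp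
  · rw [hU, Matrix.diagonal_conjTranspose, RcheckMatrix, RcheckMatrix, Matrix.mul_smul,
      Matrix.smul_mul]
    congr 1
    ext p q
    rw [Matrix.mul_diagonal, Matrix.diagonal_mul]
    fin_cases p <;> fin_cases q <;> simp

end ThreeDim

/-! ### Assembly. -/

theorem mainTheorem5 :
    -- irreducible three-dimensional representations occur exactly for `n = 3` and `n = 6`
    (∀ (n : ℕ) [NeZero n],
      (∃ (V : Type u) (_ : AddCommGroup V) (_ : Module ℂ V)
          (_ : Module (QuantumDouble (DihedralGroup n)) V)
          (_ : IsScalarTower ℂ (QuantumDouble (DihedralGroup n)) V),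
        IsSimpleModule (QuantumDouble (DihedralGroup n)) V ∧ Module.finrank ℂ V = 3) ↔
      n = 3 ∨ n = 6) ∧
    -- each gives solutions of the constant Yang–Baxter equations, and `Ř` has the displayed form
    -- in a basis in which the representation is unitary
    (∀ (n : ℕ) [NeZero n] (V : Type u) [AddCommGroup V] [Module ℂ V]
        [Module (QuantumDouble (DihedralGroup n)) V]
        [IsScalarTower ℂ (QuantumDouble (DihedralGroup n)) V],
      IsSimpleModule (QuantumDouble (DihedralGroup n)) V → Module.finrank ℂ V = 3 →
      YangBaxter.IsConstantSolution (QuantumDouble.R (DihedralGroup n) V) ∧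
      YangBaxter.IsBraidSolution (QuantumDouble.Rcheck (DihedralGroup n) V) ∧
      ∃ (e : Module.Basis (Fin 3) ℂ V) (a b : Fin 2),
        (∀ g : DihedralGroup n,
          LinearMap.toMatrix e e
              (QuantumDouble.rep (DihedralGroup n) V (QuantumDouble.ofGroup g)) ∈
            Matrix.unitaryGroup (Fin 3) ℂ) ∧
        (∀ h : DihedralGroup n,
          (LinearMap.toMatrix e e
            (QuantumDouble.rep (DihedralGroup n) V (QuantumDouble.dual h))).IsHermitian) ∧
        (n = 3 → a = 0) ∧
        (n = 6 → QuantumDouble.rep (DihedralGroup n) V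
            (QuantumDouble.ofGroup (DihedralGroup.r 3)) = (-1 : ℂ) ^ (a : ℕ) • LinearMap.id) ∧
        LinearMap.toMatrix (ThreeDim.tensorBasis e) (ThreeDim.tensorBasis e)
            (QuantumDouble.Rcheck (DihedralGroup n) V) =
          ThreeDim.RcheckMatrix a b) ∧
    -- for fixed `b`, the two displayed matrices are unitarily equivalent
    (∀ b : Fin 2, ∃ U ∈ Matrix.unitaryGroup (Fin 3) ℂ,
      ThreeDim.tensorSquare U * ThreeDim.RcheckMatrix 0 b * (ThreeDim.tensorSquare U).conjTranspose =
        ThreeDim.RcheckMatrix 1 b) ∧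
    -- up to an overall sign, the solutions from any two unitary irreducible three-dimensional
    -- representations are unitarily equivalent
    (∀ (n m : ℕ) [NeZero n] [NeZero m]
        (V : Type u) [NormedAddCommGroup V] [InnerProductSpace ℂ V]
        [Module (QuantumDouble (DihedralGroup n)) V]
        [IsScalarTower ℂ (QuantumDouble (DihedralGroup n)) V]
        (W : Type v) [NormedAddCommGroup W] [InnerProductSpace ℂ W]
        [Module (QuantumDouble (DihedralGroup m)) W]
        [IsScalarTower ℂ (QuantumDouble (DihedralGroup m)) W],
      IsSimpleModule (QuantumDouble (DihedralGroup n)) V → Module.finrank ℂ V = 3 →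
      IsSimpleModule (QuantumDouble (DihedralGroup m)) W → Module.finrank ℂ W = 3 →
      QuantumDouble.IsUnitaryAction (DihedralGroup n) V →
      QuantumDouble.IsUnitaryAction (DihedralGroup m) W →
      ∃ (U : V ≃ₗᵢ[ℂ] W) (ε : ℂ), (ε = 1 ∨ ε = -1) ∧
        TensorProduct.map (U.toLinearEquiv : V →ₗ[ℂ] W) (U.toLinearEquiv : V →ₗ[ℂ] W) ∘ₗ
            QuantumDouble.Rcheck (DihedralGroup n) V =
          ε • (QuantumDouble.Rcheck (DihedralGroup m) W ∘ₗ
            TensorProduct.map (U.toLinearEquiv : V →ₗ[ℂ] W) (U.toLinearEquiv : V →ₗ[ℂ] W))) := by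
  refine ⟨fun n _ => ⟨?_, ?_⟩, fun n _ V _ _ _ _ hS h3 => ?_,
    fun b => ThreeDim.exists_unitary_conj_RcheckMatrix b,
    fun n m _ _ V _ _ _ _ W _ _ _ _ hSV h3V hSW h3W hV hW => ?_⟩
  · rintro ⟨V, _, _, _, _, hS, h3⟩
    exact (QuantumDouble.exists_adapted_basis hS h3).1
  · intro hn
    have hcard : Fintype.card {x : DihedralGroup n // IsConj (DihedralGroup.sr 0) x} = 3 := by
      rcases hn with rfl | rfl
      · convert QuantumDouble.card_conjClass_sr_three
      · convert QuantumDouble.card_conjClass_sr_six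
    have h := QuantumDouble.exists_simple_finrank_eq_card_conjClass.{u}
      (DihedralGroup.sr (0 : ZMod n))
    rwa [hcard] at h
  · obtain ⟨-, e, i, lam, nu, he, hnu⟩ := QuantumDouble.exists_adapted_basis hS h3
    have sign : ∀ c : ℂ, (c = 1 ∨ c = -1) → ∃ a : Fin 2, c = (-1) ^ (a : ℕ) ∧ (c = 1 → a = 0) := by
      rintro c (rfl | rfl)
      · exact ⟨0, by simp, fun _ => rfl⟩
      · exact ⟨1, by simp, fun h => absurd h (by norm_num)⟩
    obtain ⟨a, ha, ha0⟩ := sign nu he.nu_sign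
    obtain ⟨b, hb, -⟩ := sign lam he.lam_sign
    exact ⟨QuantumDouble.isConstantSolution_R _ V, QuantumDouble.isBraidSolution_Rcheck _ V, e, a, b,
      he.toMatrix_mem_unitaryGroup, he.isHermitian_toMatrix_dual, fun h => ha0 (hnu h),
      fun _ => ha ▸ he.rep_r_three, he.toMatrix_Rcheck ha hb⟩
  · obtain ⟨f, c, hc, hf⟩ := QuantumDouble.exists_orthonormalBasis_Rcheck hSV h3V hV
    obtain ⟨f', c', hc', hf'⟩ := QuantumDouble.exists_orthonormalBasis_Rcheck hSW h3W hW
    have hU : ∀ j, f.equiv f' (Equiv.refl _) (f j) = f' j := fun j => by simp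
    -- The isometry matches the two bases, in which `Ř` is `c` and `c'` times the same braiding; the
    -- ratio of these signs is `c * c'`.
    refine ⟨f.equiv f' (Equiv.refl _), c * c', ?_, ?_⟩
    · rcases hc with rfl | rfl <;> rcases hc' with rfl | rfl <;> simp
    · have hcc : c' * c' = 1 := by rcases hc' with rfl | rfl <;> simp
      refine (f.toBasis.tensorProduct f.toBasis).ext fun ⟨j, k⟩ => ?_
      simp only [Module.Basis.tensorProduct_apply, OrthonormalBasis.coe_toBasis,
        LinearMap.comp_apply, LinearMap.smul_apply, hf, map_smul, TensorProduct.map_tmul,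
        LinearEquiv.coe_coe, LinearIsometryEquiv.coe_toLinearEquiv, hU, hf', smul_smul]
      rw [mul_assoc, hcc, mul_one]
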